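/- Let $K$ be a field, let $R=K[x_1,\dots,x_n]$, and fix an admissible term ordering on $R$ (a well-ordering of the terms, i.e. the monomials with coefficient $1$, compatible with multiplication). For $0\ne f\in R$ write $\mathrm{lt}(f)$ and $\mathrm{lc}(f)$ for its leading term and leading coefficient, and for nonzero $f,g$ with $L=\mathrm{lcm}(\mathrm{lt}(f),\mathrm{lt}(g))$ put $$S(f,g)=\mathrm{lc}(g)\frac{L}{\mathrm{lt}(f)}f-\mathrm{lc}(f)\frac{L}{\mathrm{lt}(g)}g .$$ A finite family $G=(g_1,\dots,g_m)$ of nonzero polynomials of $R$ is a *Gröbner basis* if for every nonzero $p$ in the ideal generated by $G$ there is some $i$ with $\mathrm{lt}(g_i)\mid\mathrm{lt}(p)$. A polynomial $p$ *reduces to zero with respect to $G$* if $p=0$, or there are (nonzero) monomials $q_1,\dots,q_r$ and indices $\nu_1,\dots,\nu_r\in\{1,\dots,m\}$ such that $p=q_1g_{\nu_1}+\dots+q_rg_{\nu_r}$ and, for each $s=1,\dots,r$, the term $\mathrm{lt}(q_s)\mathrm{lt}(g_{\nu_s})$ occurs with nonzero coefficient in $p-q_1g_{\nu_1}-\dots-q_{s-1}g_{\nu_{s-1}}$.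 A list $(t_1,\dots,t_r)$ of terms satisfies the *Extended Criterion* if - (EDiv) $\gcd(t_1,t_r)$ divides $t_\ell$ for every $\ell=1,\dots,r$; and - (EVar) for every variable $x$, either $\deg_x\gcd(t_1,t_r)=0$ or the sequence $\deg_x t_1,\dots,\deg_x t_r$ is monotonic (non-decreasing or non-increasing). **Theorem.** Let $G=(g_1,\dots,g_m)$ be a finite family of nonzero polynomials of $R$. The following are equivalent. (A) $G$ is a Gröbner basis. (B) For all $1\le i<j\le m$, at least one of the following holds: - (B0) $S(g_i,g_j)$ reduces to zero with respect to $G$. - (B1) $\mathrm{lt}(g_i)$ and $\mathrm{lt}(g_j)$ are relatively prime. - (B2) There exist indices $k_1,\dots,k_r\in\{1,\dots,m\}$ with $k_1=i$ and $k_r=j$ such that each $\mathrm{lt}(g_{k_\ell})$ divides $\mathrm{lcm}(\mathrm{lt}(g_i),\mathrm{lt}(g_j))$ and each $S(g_{k_\ell},g_{k_{\ell+1}})$, $1\le\ell<r$, reduces to zero with respect to $G$. - (B3) There exist indices $k_1,\dots,k_r\in\{1,\dots,m\}$ with $k_1=i$ and $k_r=j$ such that the list $(\mathrm{lt}(g_{k_1}),\dots,\mathrm{lt}(g_{k_r}))$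 satisfies the Extended Criterion and each $S(g_{k_\ell},g_{k_{\ell+1}})$, $1\le\ell<r$, reduces to zero with respect to $G'=(g_{k_1},\dots,g_{k_r})$. -/

import Mathlib

open MvPolynomial

namespace ExtendedCriterion

/-! A term (monic monomial) `x^a` in `n` variables is represented by its exponent vector
`a : Fin n →₀ ℕ`: divisibility of terms is `≤`, the product is `+`, the gcd is `⊓`, the lcm is `⊔`,
the term `1` is `0`, and `deg_x` is evaluation at the variable. The leading term of a nonzero
polynomial `f` is `ord.degree f`; its terms are the elements of `f.support`. -/

/-- `G` is a Gröbner basis: the leading term of each nonzero element of the ideal generated by `G`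
is divisible by the leading term of a member of `G`. -/
def IsGroebnerBasis {n : ℕ} {K ι : Type*} [Field K] (ord : MonomialOrder (Fin n))
    (G : ι → MvPolynomial (Fin n) K) : Prop :=
  ∀ p ∈ Ideal.span (Set.range G), p ≠ 0 → ∃ i, ord.degree (G i) ≤ ord.degree p

/-- `p` reduces to zero with respect to the family `G`: `p = 0`, or `p` is a sum
`q₁ g_{ν₁} + ⋯ + q_r g_{ν_r}` with monomials `q_i`, where each `lt(q_i) lt(g_{ν_i})` is a term of
`p - q₁ g_{ν₁} - ⋯ - q_{i-1} g_{ν_{i-1}}`. -/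
def ReducesToZero {n : ℕ} {K ι : Type*} [Field K] (ord : MonomialOrder (Fin n))
    (G : ι → MvPolynomial (Fin n) K) (p : MvPolynomial (Fin n) K) : Prop :=
  p = 0 ∨ ∃ (r : ℕ) (q : Fin r → MvPolynomial (Fin n) K) (ν : Fin r → ι),
    (∀ i, ∃ (a : Fin n →₀ ℕ) (c : K), c ≠ 0 ∧ q i = monomial a c) ∧
    p = ∑ i, q i * G (ν i) ∧
    ∀ i, ord.degree (q i) + ord.degree (G (ν i)) ∈
      (p - ∑ j ∈ Finset.Iio i, q j * G (ν j)).support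

/-- The gcd of the first and the last term divides every term of the list. -/
def EDiv {n r : ℕ} (t : Fin (r + 1) → (Fin n →₀ ℕ)) : Prop :=
  ∀ l, t 0 ⊓ t (Fin.last r) ≤ t l

/-- Each variable has degree zero in the gcd of the first and the last term, or its degrees along
the list are monotonic (in either direction). -/
def EVar {n r : ℕ} (t : Fin (r + 1) → (Fin n →₀ ℕ)) : Prop :=
  ∀ x : Fin n, (t 0 ⊓ t (Fin.last r)) x = 0 ∨
    Monotone (fun l => t l x) ∨ Antitone (fun l => t l x)

/-- The Extended Criterion for a nonempty list of terms. -/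
def EC {n r : ℕ} (t : Fin (r + 1) → (Fin n →₀ ℕ)) : Prop :=
  EDiv t ∧ EVar t

section Conditions

variable {n m : ℕ} {K : Type*} [Field K] (ord : MonomialOrder (Fin n))
  (G : Fin m → MvPolynomial (Fin n) K) (i j : Fin m)

/-- The S-polynomial of the pair reduces to zero with respect to `G`. -/
def B0 : Prop :=
  ReducesToZero ord G (ord.sPolynomial (G i) (G j))

/-- The leading terms of the pair are relatively prime. -/
def B1 : Prop :=
  ord.degree (G i) ⊓ ord.degree (G j) = 0

/-- There is a chain of indices from `i` to `j` whose leading terms divide the lcm of the leading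
terms of the pair and whose consecutive S-polynomials reduce to zero with respect to `G`. -/
def B2 : Prop :=
  ∃ (r : ℕ) (k : Fin (r + 1) → Fin m), k 0 = i ∧ k (Fin.last r) = j ∧
    (∀ l, ord.degree (G (k l)) ≤ ord.degree (G i) ⊔ ord.degree (G j)) ∧
    ∀ l : Fin r, ReducesToZero ord G (ord.sPolynomial (G (k l.castSucc)) (G (k l.succ)))

/-- There is a chain of indices from `i` to `j` whose leading terms satisfy the Extended Criterion
and whose consecutive S-polynomials reduce to zero with respect to the subfamily `G ∘ k`. -/
def B3 : Prop :=
  ∃ (r : ℕ) (k : Fin (r + 1) → Fin m), k 0 = i ∧ k (Fin.last r) = j ∧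
    EC (fun l => ord.degree (G (k l))) ∧
    ∀ l : Fin r,
      ReducesToZero ord (G ∘ k) (ord.sPolynomial (G (k l.castSucc)) (G (k l.succ)))

end Conditions

end ExtendedCriterion

/-! The proof turns on one property of a pair f, g in the family: S(f, g) is a combination of
multiples x^a g_k whose leading terms lie strictly below lcm(lt(f), lt(g)), i.e. it lies in a
`leadSpan` over `Set.Iio`. By Buchberger's criterion, this property for all pairs makes G a Gröbner
basis. So (B) ⇒ (A) means deriving it from each of (B0)–(B3), while (A) ⇒ (B0) is the division
algorithm.

For (B0), every multiple used in a reduction stays below the same bound as the polynomial reduced.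
For (B2), the differences of monic multiples telescope along the chain. For (B1), and more generally
for f = ca, g = cb with lt(a), lt(b) coprime, cancelling abc leaves only the tails of a and b
(`sPolynomial_mem_leadSpan_of_eq_mul`).

For (B3), each consecutive S-polynomial gives a syzygy of the chain; reduction with respect to G'
keeps all syzygies among the chain members. Cramer's rule turns them into P g_i = Q g_j, where deg P
is the sum of the consecutive lcms minus the sum of all leading exponents but the last
(`exists_mul_eq_mul_of_chain`). Write g_i = ca, g_j = cb with a, b coprime. Then b divides P, and
comparing degrees in each variable under (EVar) makes lt(a), lt(b) coprime, so the (B1) argument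
applies. -/

namespace ExtendedCriterion

/-- The `K`-span of the products `x^a * G i` whose leading term lies in `S`. -/
noncomputable def leadSpan {σ K ι : Type*} [Field K] (ord : MonomialOrder σ)
    (G : ι → MvPolynomial σ K) (S : Set ord.syn) : Submodule K (MvPolynomial σ K) :=
  Submodule.span K {f | ∃ a i, ord.toSyn (a + ord.degree (G i)) ∈ S ∧ f = monomial a 1 * G i}

/-- The monic multiple of `f` with leading term `d`, provided `ord.degree f ≤ d`. -/
noncomputable def monicMultiple {σ K : Type*} [Field K] (ord : MonomialOrder σ)
    (d : σ →₀ ℕ) (f : MvPolynomial σ K) : MvPolynomial σ K :=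
  monomial (d - ord.degree f) (ord.leadingCoeff f)⁻¹ * f

/-! ### Spans with bounded leading terms, and the descent behind Buchberger's criterion -/

section LeadSpan

variable {σ K ι : Type*} [Field K] {ord : MonomialOrder σ} {G : ι → MvPolynomial σ K}

theorem leadSpan_mono {S T : Set ord.syn} (h : S ⊆ T) : leadSpan ord G S ≤ leadSpan ord G T :=
  Submodule.span_mono fun _ ⟨a, i, ha, hf⟩ => ⟨a, i, h ha, hf⟩

theorem leadSpan_comp_le {κ : Type*} (k : κ → ι) (S : Set ord.syn) :
    leadSpan ord (G ∘ k) S ≤ leadSpan ord G S :=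
  Submodule.span_mono fun _ ⟨a, i, ha, hf⟩ => ⟨a, k i, ha, hf⟩

theorem monomial_mul_mem_leadSpan {S : Set ord.syn} {a : σ →₀ ℕ} {i : ι}
    (h : ord.toSyn (a + ord.degree (G i)) ∈ S) (c : K) :
    monomial a c * G i ∈ leadSpan ord G S := by
  have : monomial a c * G i = c • (monomial a 1 * G i) := by
    rw [← smul_mul_assoc, smul_monomial, smul_eq_mul, mul_one]
  rw [this]
  exact Submodule.smul_mem _ _ (Submodule.subset_span ⟨a, i, h, rfl⟩)

theorem mul_mem_leadSpan {S : Set ord.syn} {h : MvPolynomial σ K} {i : ι}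
    (hh : ∀ s ∈ h.support, ord.toSyn (s + ord.degree (G i)) ∈ S) :
    h * G i ∈ leadSpan ord G S := by
  rw [h.as_sum, Finset.sum_mul]
  exact Submodule.sum_mem _ fun s hs => monomial_mul_mem_leadSpan (hh s hs) _

theorem monomial_mul_mem_leadSpan_Iio {d : σ →₀ ℕ} {f : MvPolynomial σ K}
    (hf : f ∈ leadSpan ord G (Set.Iio (ord.toSyn d))) (a : σ →₀ ℕ) (c : K) :
    monomial a c * f ∈ leadSpan ord G (Set.Iio (ord.toSyn (a + d))) := by
  induction hf using Submodule.span_induction with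
  | mem f hf =>
    obtain ⟨b, i, hb, rfl⟩ := hf
    rw [← mul_assoc, monomial_mul]
    apply monomial_mul_mem_leadSpan
    simp only [Set.mem_Iio] at hb ⊢
    rw [add_assoc, map_add _ a, map_add _ a]
    gcongr
  | zero => simp
  | add f g _ _ hf hg => rw [mul_add]; exact add_mem hf hg
  | smul r f _ hf => rw [mul_smul_comm]; exact Submodule.smul_mem _ _ hf

theorem monomial_mul_mem_leadSpan_Iic {d : σ →₀ ℕ} {f : MvPolynomial σ K}
    (hf : f ∈ leadSpan ord G (Set.Iic (ord.toSyn d))) (a : σ →₀ ℕ) (c : K) :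
    monomial a c * f ∈ leadSpan ord G (Set.Iic (ord.toSyn (a + d))) := by
  induction hf using Submodule.span_induction with
  | mem f hf =>
    obtain ⟨b, i, hb, rfl⟩ := hf
    rw [← mul_assoc, monomial_mul]
    apply monomial_mul_mem_leadSpan
    simp only [Set.mem_Iic] at hb ⊢
    rw [add_assoc, map_add _ a, map_add _ a]
    gcongr
  | zero => simp
  | add f g _ _ hf hg => rw [mul_add]; exact add_mem hf hg
  | smul r f _ hf => rw [mul_smul_comm]; exact Submodule.smul_mem _ _ hf

theorem le_of_mem_support_monomial_mul {a s : σ →₀ ℕ} {c : K} {f : MvPolynomial σ K}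
    (hs : s ∈ (monomial a c * f).support) :
    ord.toSyn s ≤ ord.toSyn (a + ord.degree f) := by
  refine (ord.le_degree hs).trans (ord.toSyn_degree_mul_le.trans ?_)
  rw [map_add]
  gcongr
  exact ord.degree_monomial_le c

theorem exists_mem_of_mem_support {S : Set ord.syn} {f : MvPolynomial σ K}
    (hf : f ∈ leadSpan ord G S) {s : σ →₀ ℕ} (hs : s ∈ f.support) :
    ∃ t ∈ S, ord.toSyn s ≤ t := by
  classical
  induction hf using Submodule.span_induction with
  | mem f hf =>
    obtain ⟨b, i, hb, rfl⟩ := hf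
    exact ⟨_, hb, le_of_mem_support_monomial_mul hs⟩
  | zero => simp at hs
  | add f g _ _ hf hg =>
    rcases Finset.mem_union.1 (support_add hs) with h | h
    · exact hf h
    · exact hg h
  | smul r f _ hf => exact hf (support_smul hs)

theorem lt_of_mem_support {d : σ →₀ ℕ} {f : MvPolynomial σ K}
    (hf : f ∈ leadSpan ord G (Set.Iio (ord.toSyn d))) {s : σ →₀ ℕ} (hs : s ∈ f.support) :
    ord.toSyn s < ord.toSyn d := by
  obtain ⟨t, ht, h⟩ := exists_mem_of_mem_support hf hs
  exact h.trans_lt ht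

theorem lt_degree_of_mem_support_sub_leadingTerm {f : MvPolynomial σ K} {s : σ →₀ ℕ}
    (hs : s ∈ (f - ord.leadingTerm f).support) : ord.toSyn s < ord.toSyn (ord.degree f) := by
  classical
  rw [mem_support_iff, coeff_sub, MonomialOrder.leadingTerm, coeff_monomial] at hs
  split_ifs at hs with h
  · rw [← h] at hs
    exact absurd (sub_self _) hs
  · rw [sub_zero] at hs
    exact (ord.le_degree (mem_support_iff.2 hs)).lt_of_ne fun e => h (ord.toSyn.injective e).symm

theorem lt_sup_of_mem_support_sPolynomial {f g : MvPolynomial σ K} {s : σ →₀ ℕ}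
    (hs : s ∈ (ord.sPolynomial f g).support) :
    ord.toSyn s < ord.toSyn (ord.degree f ⊔ ord.degree g) := by
  have h0 : ord.sPolynomial f g ≠ 0 := fun h => by simp [h] at hs
  exact (ord.le_degree hs).trans_lt (ord.degree_sPolynomial_lt_sup_degree h0)

/-- A common factor with complementary leading terms gives a representation of the S-polynomial
below the lcm of the leading terms. -/
theorem sPolynomial_mem_leadSpan_of_eq_mul {i j : ι} {a b c : MvPolynomial σ K} (hi : G i = c * a)
    (hj : G j = c * b) (hGi : G i ≠ 0) (hGj : G j ≠ 0) (hab : ord.degree a ⊓ ord.degree b = 0) :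
    ord.sPolynomial (G i) (G j) ∈
      leadSpan ord G (Set.Iio (ord.toSyn (ord.degree (G i) ⊔ ord.degree (G j)))) := by
  have hc : c ≠ 0 := fun h => hGi (by simp [hi, h])
  have ha : a ≠ 0 := fun h => hGi (by simp [hi, h])
  have hb : b ≠ 0 := fun h => hGj (by simp [hj, h])
  have hmin (x : σ) : min (ord.degree a x) (ord.degree b x) = 0 := by
    simpa using DFunLike.congr_fun hab x
  have di : ord.degree (G i) = ord.degree c + ord.degree a := by rw [hi, ord.degree_mul hc ha]
  have dj : ord.degree (G j) = ord.degree c + ord.degree b := by rw [hj, ord.degree_mul hc hb]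
  have dij : ord.degree (G j) - ord.degree (G i) = ord.degree b := by
    ext x; have := hmin x; simp [di, dj]; omega
  have dji : ord.degree (G i) - ord.degree (G j) = ord.degree a := by
    ext x; have := hmin x; simp [di, dj]; omega
  have dsup : ord.degree (G i) ⊔ ord.degree (G j) = ord.degree a + ord.degree (G j) := by
    ext x; have := hmin x; simp [di, dj]; omega
  have dsup' : ord.degree (G i) ⊔ ord.degree (G j) = ord.degree b + ord.degree (G i) := by
    ext x; have := hmin x; simp [di, dj]; omega
  -- Since a * G j = b * G i, replacing the leading terms of a and b by their tails only changes the
  -- sign.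
  have key : ord.sPolynomial (G i) (G j) =
      ord.leadingCoeff c • ((a - ord.leadingTerm a) * G j - (b - ord.leadingTerm b) * G i) := by
    have e1 : monomial (ord.degree b) (ord.leadingCoeff (G j)) =
        C (ord.leadingCoeff c) * ord.leadingTerm b := by
      rw [hj, ord.leadingCoeff_mul, MonomialOrder.leadingTerm, C_mul_monomial]
    have e2 : monomial (ord.degree a) (ord.leadingCoeff (G i)) =
        C (ord.leadingCoeff c) * ord.leadingTerm a := by
      rw [hi, ord.leadingCoeff_mul, MonomialOrder.leadingTerm, C_mul_monomial]
    rw [MonomialOrder.sPolynomial, dij, dji, e1, e2, smul_eq_C_mul, hi, hj]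
    ring
  rw [key]
  refine Submodule.smul_mem _ _ (sub_mem (mul_mem_leadSpan fun s hs => ?_)
    (mul_mem_leadSpan fun s hs => ?_))
  · rw [dsup, Set.mem_Iio, map_add, map_add]
    gcongr
    exact lt_degree_of_mem_support_sub_leadingTerm hs
  · rw [dsup', Set.mem_Iio, map_add, map_add]
    gcongr
    exact lt_degree_of_mem_support_sub_leadingTerm hs

/-- Normalizing leading coefficients makes S-polynomials, up to a monomial factor, differences of
monic multiples; such differences telescope. -/
theorem monicMultiple_sub {f g : MvPolynomial σ K} (hf : f ≠ 0) (hg : g ≠ 0) {d : σ →₀ ℕ}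
    (hfd : ord.degree f ≤ d) (hgd : ord.degree g ≤ d) :
    monicMultiple ord d f - monicMultiple ord d g =
      monomial (d - (ord.degree f ⊔ ord.degree g))
        ((ord.leadingCoeff f)⁻¹ * (ord.leadingCoeff g)⁻¹) * ord.sPolynomial f g := by
  have hf' := ord.leadingCoeff_ne_zero_iff.2 hf
  have hg' := ord.leadingCoeff_ne_zero_iff.2 hg
  rw [MonomialOrder.sPolynomial_def, mul_sub, ← mul_assoc, ← mul_assoc, monomial_mul, monomial_mul,
    tsub_add_tsub_cancel (sup_le hfd hgd) le_sup_left,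
    tsub_add_tsub_cancel (sup_le hfd hgd) le_sup_right, inv_mul_cancel_right₀ hg', mul_comm,
    mul_comm (_ * _) (ord.leadingCoeff f), mul_inv_cancel_left₀ hf', mul_comm]
  rfl

theorem monicMultiple_sub_mem {i j : ι} (hi : G i ≠ 0) (hj : G j ≠ 0) {d : σ →₀ ℕ}
    (hid : ord.degree (G i) ≤ d) (hjd : ord.degree (G j) ≤ d)
    (h : ord.sPolynomial (G i) (G j) ∈
      leadSpan ord G (Set.Iio (ord.toSyn (ord.degree (G i) ⊔ ord.degree (G j))))) :
    monicMultiple ord d (G i) - monicMultiple ord d (G j) ∈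
      leadSpan ord G (Set.Iio (ord.toSyn d)) := by
  rw [monicMultiple_sub hi hj hid hjd]
  have := monomial_mul_mem_leadSpan_Iio h (d - (ord.degree (G i) ⊔ ord.degree (G j)))
    ((ord.leadingCoeff (G i))⁻¹ * (ord.leadingCoeff (G j))⁻¹)
  rwa [tsub_add_cancel_of_le (sup_le hid hjd)] at this

theorem sPolynomial_mem_of_monicMultiple_sub_mem {f g : MvPolynomial σ K} (hf : f ≠ 0) (hg : g ≠ 0)
    {M : Submodule K (MvPolynomial σ K)}
    (h : monicMultiple ord (ord.degree f ⊔ ord.degree g) f -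
      monicMultiple ord (ord.degree f ⊔ ord.degree g) g ∈ M) :
    ord.sPolynomial f g ∈ M := by
  rw [monicMultiple_sub hf hg le_sup_left le_sup_right, tsub_self, monomial_zero', ← smul_eq_C_mul,
    Submodule.smul_mem_iff] at h
  · exact h
  · exact mul_ne_zero (inv_ne_zero (ord.leadingCoeff_ne_zero_iff.2 hf))
      (inv_ne_zero (ord.leadingCoeff_ne_zero_iff.2 hg))

theorem coeff_monicMultiple {f : MvPolynomial σ K} (hf : f ≠ 0) {d : σ →₀ ℕ}
    (hfd : ord.degree f ≤ d) : coeff d (monicMultiple ord d f) = 1 := by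
  obtain ⟨e, rfl⟩ := exists_add_of_le hfd
  rw [monicMultiple, add_tsub_cancel_left, add_comm, coeff_monomial_mul]
  exact inv_mul_cancel₀ (ord.leadingCoeff_ne_zero_iff.2 hf)

theorem degree_monicMultiple_le {f : MvPolynomial σ K} {d : σ →₀ ℕ}
    (hfd : ord.degree f ≤ d) : ord.toSyn (ord.degree (monicMultiple ord d f)) ≤ ord.toSyn d := by
  refine ord.degree_le_iff.2 fun s hs => ?_
  have := le_of_mem_support_monomial_mul (ord := ord) hs
  rwa [tsub_add_cancel_of_le hfd] at this

theorem exists_mem_leadSpan_Iic {p : MvPolynomial σ K} (hp : p ∈ Ideal.span (Set.range G)) :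
    ∃ d, p ∈ leadSpan ord G (Set.Iic (ord.toSyn d)) := by
  have hadd {f g : MvPolynomial σ K} (hf : ∃ d, f ∈ leadSpan ord G (Set.Iic (ord.toSyn d)))
      (hg : ∃ d, g ∈ leadSpan ord G (Set.Iic (ord.toSyn d))) :
      ∃ d, f + g ∈ leadSpan ord G (Set.Iic (ord.toSyn d)) := by
    obtain ⟨d, hd⟩ := hf
    obtain ⟨e, he⟩ := hg
    rcases le_total (ord.toSyn d) (ord.toSyn e) with h | h
    · exact ⟨e, add_mem (leadSpan_mono (Set.Iic_subset_Iic.2 h) hd) he⟩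
    · exact ⟨d, add_mem hd (leadSpan_mono (Set.Iic_subset_Iic.2 h) he)⟩
  induction hp using Submodule.span_induction with
  | mem f hf =>
    obtain ⟨i, rfl⟩ := hf
    refine ⟨ord.degree (G i), ?_⟩
    have := monomial_mul_mem_leadSpan (ord := ord) (G := G) (i := i) (a := 0)
      (S := Set.Iic (ord.toSyn (ord.degree (G i)))) (by simp) 1
    simpa using this
  | zero => exact ⟨0, zero_mem _⟩
  | add f g _ _ hf hg => exact hadd hf hg
  | smul r f _ hf =>
    rw [smul_eq_mul]
    induction r using MvPolynomial.induction_on' with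
    | monomial u c =>
      obtain ⟨d, hd⟩ := hf
      exact ⟨u + d, monomial_mul_mem_leadSpan_Iic hd u c⟩
    | add r s hr hs => rw [add_mul]; exact hadd hr hs

/-- Only finitely many generators occur, so their largest leading term serves as e. Zero is excluded
because d may be minimal. -/
theorem exists_mem_leadSpan_Iic_of_mem_Iio {d : σ →₀ ℕ} {p : MvPolynomial σ K}
    (hp : p ∈ leadSpan ord G (Set.Iio (ord.toSyn d))) (h0 : p ≠ 0) :
    ∃ e, ord.toSyn e < ord.toSyn d ∧ p ∈ leadSpan ord G (Set.Iic (ord.toSyn e)) := by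
  have : p = 0 ∨ ∃ e, ord.toSyn e < ord.toSyn d ∧ p ∈ leadSpan ord G (Set.Iic (ord.toSyn e)) := by
    clear h0
    induction hp using Submodule.span_induction with
    | mem f hf =>
      obtain ⟨a, i, ha, rfl⟩ := hf
      exact Or.inr ⟨_, ha, monomial_mul_mem_leadSpan (by simp) 1⟩
    | zero => exact Or.inl rfl
    | add f g _ _ hf hg =>
      rcases hf with rfl | ⟨a, ha, hf⟩
      · rwa [zero_add]
      rcases hg with rfl | ⟨b, hb, hg⟩
      · rw [add_zero]; exact Or.inr ⟨a, ha, hf⟩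
      rcases le_total (ord.toSyn a) (ord.toSyn b) with h | h
      · exact Or.inr ⟨b, hb, add_mem (leadSpan_mono (Set.Iic_subset_Iic.2 h) hf) hg⟩
      · exact Or.inr ⟨a, ha, add_mem hf (leadSpan_mono (Set.Iic_subset_Iic.2 h) hg)⟩
    | smul r f _ hf =>
      rcases hf with rfl | ⟨a, ha, hf⟩
      · exact Or.inl (smul_zero _)
      · exact Or.inr ⟨a, ha, Submodule.smul_mem _ _ hf⟩
  exact this.resolve_left h0

theorem leadSpan_Iic_le_Iio_or_exists_degree_le (d : σ →₀ ℕ) :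
    leadSpan ord G (Set.Iic (ord.toSyn d)) ≤ leadSpan ord G (Set.Iio (ord.toSyn d)) ∨
      ∃ i, ord.degree (G i) ≤ d := by
  refine or_iff_not_imp_right.2 fun h => Submodule.span_le.2 ?_
  rintro _ ⟨a, i, ha, rfl⟩
  have hne : ord.toSyn (a + ord.degree (G i)) ≠ ord.toSyn d := fun e =>
    h ⟨i, ord.toSyn.injective e ▸ le_add_self⟩
  exact monomial_mul_mem_leadSpan (Set.mem_Iio.2 (lt_of_le_of_ne (Set.mem_Iic.1 ha) hne)) 1

/-- If the S-polynomials of all pairs are represented below the lcm of the leading terms, then an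
element of the span up to `d` without the term `d` lies in the span strictly below `d`. -/
theorem mem_leadSpan_Iio_of_coeff_eq_zero (hG : ∀ i, G i ≠ 0)
    (hS : ∀ i j, ord.sPolynomial (G i) (G j) ∈
      leadSpan ord G (Set.Iio (ord.toSyn (ord.degree (G i) ⊔ ord.degree (G j)))))
    {d : σ →₀ ℕ} {p : MvPolynomial σ K} (hp : p ∈ leadSpan ord G (Set.Iic (ord.toSyn d)))
    (hd : coeff d p = 0) : p ∈ leadSpan ord G (Set.Iio (ord.toSyn d)) := by
  rcases leadSpan_Iic_le_Iio_or_exists_degree_le (G := G) (ord := ord) d with h | ⟨k, hk⟩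
  · exact h hp
  -- Modulo the span below d, all generators with leading term d are multiples of the single one
  -- coming from `G k`.
  have hle : leadSpan ord G (Set.Iic (ord.toSyn d)) ≤
      leadSpan ord G (Set.Iio (ord.toSyn d)) ⊔ Submodule.span K {monicMultiple ord d (G k)} := by
    refine Submodule.span_le.2 ?_
    rintro _ ⟨a, i, ha, rfl⟩
    rcases lt_or_eq_of_le (Set.mem_Iic.1 ha) with h | h
    · exact Submodule.mem_sup_left (monomial_mul_mem_leadSpan h 1)
    have had := ord.toSyn.injective h
    have hid : ord.degree (G i) ≤ d := had ▸ le_add_self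
    have hai : a = d - ord.degree (G i) := by rw [← had, add_tsub_cancel_right]
    have e : monomial a 1 * G i = ord.leadingCoeff (G i) •
        ((monicMultiple ord d (G i) - monicMultiple ord d (G k)) + monicMultiple ord d (G k)) := by
      rw [sub_add_cancel, monicMultiple, ← smul_mul_assoc, smul_monomial, smul_eq_mul,
        mul_inv_cancel₀ (ord.leadingCoeff_ne_zero_iff.2 (hG i)), hai]
    rw [e]
    exact Submodule.smul_mem _ _ (Submodule.add_mem_sup
      (monicMultiple_sub_mem (hG i) (hG k) hid hk (hS i k)) (Submodule.mem_span_singleton_self _))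
  obtain ⟨w, hw, v, hv, rfl⟩ := Submodule.mem_sup.1 (hle hp)
  obtain ⟨c, rfl⟩ := Submodule.mem_span_singleton.1 hv
  -- The coefficient at d therefore reads off the multiplier c, which must vanish.
  have hw0 : coeff d w = 0 := by
    by_contra h
    exact lt_irrefl _ (lt_of_mem_support hw (mem_support_iff.2 h))
  have hc : c = 0 := by
    rwa [coeff_add, coeff_smul, coeff_monicMultiple (hG k) hk, hw0, zero_add, smul_eq_mul,
      mul_one] at hd
  rwa [hc, zero_smul, add_zero]

/-- Well-founded descent on the bound d: it can be lowered until the term d really occurs in p, and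
then d is the leading term of p. -/
theorem exists_degree_le_of_mem_leadSpan (hG : ∀ i, G i ≠ 0)
    (hS : ∀ i j, ord.sPolynomial (G i) (G j) ∈
      leadSpan ord G (Set.Iio (ord.toSyn (ord.degree (G i) ⊔ ord.degree (G j)))))
    {p : MvPolynomial σ K} (h0 : p ≠ 0) (d : σ →₀ ℕ)
    (hp : p ∈ leadSpan ord G (Set.Iic (ord.toSyn d))) : ∃ i, ord.degree (G i) ≤ ord.degree p := by
  induction hs : ord.toSyn d using WellFoundedLT.induction generalizing d with
  | ind s ih =>
    subst hs
    by_cases hd : coeff d p = 0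
    · obtain ⟨e, he, hpe⟩ :=
        exists_mem_leadSpan_Iic_of_mem_Iio (mem_leadSpan_Iio_of_coeff_eq_zero hG hS hp hd) h0
      exact ih _ he e hpe rfl
    · obtain ⟨t, ht, hpt⟩ := exists_mem_of_mem_support hp (ord.degree_mem_support h0)
      have : ord.degree p = d := ord.toSyn.injective
        (le_antisymm (hpt.trans ht) (ord.le_degree (mem_support_iff.2 hd)))
      rw [this]
      refine (leadSpan_Iic_le_Iio_or_exists_degree_le d).resolve_left fun h => ?_
      exact lt_irrefl _ (lt_of_mem_support (h hp) (mem_support_iff.2 hd))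

end LeadSpan

/-! ### Reduction to zero -/

section Reduction

variable {n : ℕ} {K ι : Type*} [Field K] {ord : MonomialOrder (Fin n)}
  {G : ι → MvPolynomial (Fin n) K}

theorem ReducesToZero.mem_leadSpan {p : MvPolynomial (Fin n) K} (h : ReducesToZero ord G p)
    {d : Fin n →₀ ℕ} (hp : ∀ s ∈ p.support, ord.toSyn s < ord.toSyn d) :
    p ∈ leadSpan ord G (Set.Iio (ord.toSyn d)) := by
  classical
  rcases h with rfl | ⟨r, q, ν, hq, hsum, hsupp⟩
  · exact zero_mem _
  -- By strong induction: the leading term of the i-th multiple occurs in p or in an earlier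
  -- multiple, and both have all terms below d.
  have hmem (i : Fin r) : q i * G (ν i) ∈ leadSpan ord G (Set.Iio (ord.toSyn d)) := by
    induction i using WellFoundedLT.induction with
    | ind i ih =>
      obtain ⟨a, c, hc, hqi⟩ := hq i
      have hs := hsupp i
      rw [hqi, ord.degree_monomial, if_neg hc] at hs
      rw [hqi]
      apply monomial_mul_mem_leadSpan
      rcases Finset.mem_union.1 (support_sub _ _ _ hs) with h | h
      · exact hp _ h
      · exact lt_of_mem_support (sum_mem fun j hj => ih j (Finset.mem_Iio.1 hj)) h
  rw [hsum]
  exact sum_mem fun i _ => hmem i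

theorem ReducesToZero.sPolynomial_mem_leadSpan {f g : MvPolynomial (Fin n) K}
    (h : ReducesToZero ord G (ord.sPolynomial f g)) :
    ord.sPolynomial f g ∈
      leadSpan ord G (Set.Iio (ord.toSyn (ord.degree f ⊔ ord.degree g))) :=
  h.mem_leadSpan fun _ hs => lt_sup_of_mem_support_sPolynomial hs

theorem sum_Iio_succ {M : Type*} [AddCommMonoid M] {r : ℕ} (f : Fin (r + 1) → M) (i : Fin r) :
    ∑ j ∈ Finset.Iio i.succ, f j = f 0 + ∑ j ∈ Finset.Iio i, f j.succ := by
  have : Finset.Iio i.succ = insert 0 ((Finset.Iio i).map (Fin.succEmb r)) := by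
    ext j
    cases j using Fin.cases <;> simp
  rw [this, Finset.sum_insert (by simp), Finset.sum_map]
  rfl

theorem ReducesToZero.of_sub {p : MvPolynomial (Fin n) K} {a : Fin n →₀ ℕ} {c : K} {i : ι}
    (hc : c ≠ 0) (ha : a + ord.degree (G i) ∈ p.support)
    (h : ReducesToZero ord G (p - monomial a c * G i)) : ReducesToZero ord G p := by
  classical
  have h' : ∃ (r : ℕ) (q : Fin r → MvPolynomial (Fin n) K) (ν : Fin r → ι),
      (∀ i, ∃ (a : Fin n →₀ ℕ) (c : K), c ≠ 0 ∧ q i = monomial a c) ∧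
      p - monomial a c * G i = ∑ i, q i * G (ν i) ∧
      ∀ j, ord.degree (q j) + ord.degree (G (ν j)) ∈
        (p - monomial a c * G i - ∑ l ∈ Finset.Iio j, q l * G (ν l)).support := by
    rcases h with h | h
    · exact ⟨0, Fin.elim0, Fin.elim0, fun i => i.elim0, by simpa using h, fun i => i.elim0⟩
    · exact h
  obtain ⟨r, q, ν, hq, hsum, hsupp⟩ := h'
  refine Or.inr ⟨r + 1, Fin.cons (monomial a c) q, Fin.cons i ν, ?_, ?_, ?_⟩
  · exact Fin.cases ⟨a, c, hc, rfl⟩ hq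
  · rw [Fin.sum_univ_succ]
    simpa using sub_eq_iff_eq_add'.1 hsum
  · refine Fin.cases ?_ fun j => ?_
    · have : Finset.Iio (0 : Fin (r + 1)) = ∅ := by ext; simp
      simpa only [Fin.cons_zero, ord.degree_monomial, if_neg hc, this, Finset.sum_empty,
        sub_zero] using ha
    · rw [sum_Iio_succ]
      simpa only [Fin.cons_zero, Fin.cons_succ, ← sub_sub] using hsupp j

theorem IsGroebnerBasis.reducesToZero (h : IsGroebnerBasis ord G) (hG : ∀ i, G i ≠ 0)
    {p : MvPolynomial (Fin n) K} (hp : p ∈ Ideal.span (Set.range G)) : ReducesToZero ord G p := by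
  induction hs : ord.toSyn (ord.degree p) using WellFoundedLT.induction generalizing p with
  | ind s ih =>
    subst hs
    by_cases h0 : p = 0
    · exact Or.inl h0
    obtain ⟨i, hi⟩ := h p hp h0
    have hlc := ord.leadingCoeff_ne_zero_iff.2 h0
    have hlci := ord.leadingCoeff_ne_zero_iff.2 (hG i)
    have hadd := tsub_add_cancel_of_le hi
    refine ReducesToZero.of_sub (a := ord.degree p - ord.degree (G i)) (i := i)
      (c := ord.leadingCoeff p * (ord.leadingCoeff (G i))⁻¹)
      (mul_ne_zero hlc (inv_ne_zero hlci)) (by rw [hadd]; exact ord.degree_mem_support h0) ?_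
    set p' := p - monomial (ord.degree p - ord.degree (G i))
      (ord.leadingCoeff p * (ord.leadingCoeff (G i))⁻¹) * G i with hp'
    -- Zero has degree 0 by convention, so the degree need not drop when p is a constant.
    by_cases h0' : p' = 0
    · exact Or.inl h0'
    refine ih _ ?_ (sub_mem hp (Ideal.mul_mem_left _ _ (Ideal.subset_span ⟨i, rfl⟩))) rfl
    have hcoeff : coeff (ord.degree p) p' = 0 := by
      have : coeff (ord.degree p) (monomial (ord.degree p - ord.degree (G i))
          (ord.leadingCoeff p * (ord.leadingCoeff (G i))⁻¹) * G i) = ord.leadingCoeff p := by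
        nth_rewrite 1 [← hadd]
        rw [coeff_monomial_mul]
        exact inv_mul_cancel_right₀ hlci _
      rw [hp', coeff_sub, this]
      exact sub_self _
    refine lt_of_le_of_ne ?_ fun e => ?_
    · refine ord.degree_sub_le.trans (sup_le le_rfl (ord.degree_le_iff.2 fun s hs => ?_))
      have := le_of_mem_support_monomial_mul (ord := ord) hs
      rwa [hadd] at this
    · rw [← ord.toSyn.injective e] at hcoeff
      exact h0' (ord.coeff_degree_eq_zero_iff.1 hcoeff)

end Reduction

/-! ### Leading terms of determinants and Cramer's rule along a chain -/

section Determinant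

variable {σ K : Type*} [Field K] {ord : MonomialOrder σ}

theorem degree_prod_le_and_coeff_prod {ι : Type*} (s : Finset ι) {P : ι → MvPolynomial σ K}
    {L : ι → σ →₀ ℕ} (h : ∀ i ∈ s, ord.toSyn (ord.degree (P i)) ≤ ord.toSyn (L i)) :
    ord.toSyn (ord.degree (∏ i ∈ s, P i)) ≤ ord.toSyn (∑ i ∈ s, L i) ∧
      coeff (∑ i ∈ s, L i) (∏ i ∈ s, P i) = ∏ i ∈ s, coeff (L i) (P i) := by
  classical
  induction s using Finset.induction_on with
  | empty => simp
  | insert a s ha ih =>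
    obtain ⟨h1, h2⟩ := ih fun i hi => h i (Finset.mem_insert_of_mem hi)
    have h0 := h a (Finset.mem_insert_self a s)
    rw [Finset.prod_insert ha, Finset.prod_insert ha, Finset.sum_insert ha]
    refine ⟨ord.toSyn_degree_mul_le.trans ?_, ?_⟩
    · rw [map_add]
      exact add_le_add h0 h1
    · rw [ord.coeff_mul_of_add_of_degree_le h0 h1, h2]

/-- If the entries of the `l`-th row have degree at most `L l`, then the coefficient of the
determinant at `∑ l, L l` is the determinant of the coefficients at `L l`. -/
theorem degree_det_le_and_coeff_det {ι : Type*} [Fintype ι] [DecidableEq ι]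
    {N : Matrix ι ι (MvPolynomial σ K)} {L : ι → σ →₀ ℕ}
    (h : ∀ l k, ord.toSyn (ord.degree (N l k)) ≤ ord.toSyn (L l)) :
    ord.toSyn (ord.degree N.det) ≤ ord.toSyn (∑ l, L l) ∧
      coeff (∑ l, L l) N.det = (Matrix.of fun l k => coeff (L l) (N l k)).det := by
  have hprod (π : Equiv.Perm ι) :=
    degree_prod_le_and_coeff_prod Finset.univ (P := fun i => N (π i) i) (L := fun i => L (π i))
      fun i _ => h (π i) i
  simp only [Equiv.sum_comp] at hprod
  refine ⟨?_, ?_⟩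
  · rw [ord.degree_le_iff]
    intro s hs
    by_contra hlt
    refine mem_support_iff.1 hs ?_
    rw [Matrix.det_apply, coeff_sum]
    refine Finset.sum_eq_zero fun π _ => ?_
    have h0 : coeff s (∏ i, N (π i) i) = 0 :=
      ord.coeff_eq_zero_of_lt ((hprod π).1.trans_lt (not_le.1 hlt))
    rw [Units.smul_def, coeff_smul, h0, smul_zero]
  · rw [Matrix.det_apply, Matrix.det_apply, coeff_sum]
    refine Finset.sum_congr rfl fun π _ => ?_
    rw [Units.smul_def, Units.smul_def, coeff_smul, (hprod π).2]
    rfl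

/-- The strict bound is stated on supports because it must also hold for zero products, whose degree
is 0 and not below d = 0. -/
theorem exists_sum_eq_of_mem_leadSpan {ι : Type*} [Fintype ι] {G : ι → MvPolynomial σ K}
    {d : σ →₀ ℕ} {f : MvPolynomial σ K} (hf : f ∈ leadSpan ord G (Set.Iio (ord.toSyn d))) :
    ∃ h : ι → MvPolynomial σ K, f = ∑ k, h k * G k ∧
      ∀ k, ∀ s ∈ (h k * G k).support, ord.toSyn s < ord.toSyn d := by
  classical
  induction hf using Submodule.span_induction with
  | mem f hf =>
    obtain ⟨a, i, ha, rfl⟩ := hf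
    refine ⟨fun k => if k = i then monomial a 1 else 0, by simp, fun k s hs => ?_⟩
    simp only at hs
    split_ifs at hs with hk
    · subst hk
      exact (le_of_mem_support_monomial_mul hs).trans_lt ha
    · simp at hs
  | zero => exact ⟨0, by simp, by simp⟩
  | add f g _ _ hf hg =>
    obtain ⟨u, rfl, hu⟩ := hf
    obtain ⟨v, rfl, hv⟩ := hg
    refine ⟨u + v, by simp [add_mul, Finset.sum_add_distrib], fun k s hs => ?_⟩
    rw [Pi.add_apply, add_mul] at hs
    rcases Finset.mem_union.1 (support_add hs) with h | h
    · exact hu k s h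
    · exact hv k s h
  | smul r f _ hf =>
    obtain ⟨u, rfl, hu⟩ := hf
    refine ⟨r • u, by simp [Finset.smul_sum], fun k s hs => hu k s ?_⟩
    rw [Pi.smul_apply, smul_mul_assoc] at hs
    exact support_smul hs

/-- Along a chain whose consecutive S-polynomials are represented below the lcm of the leading
terms, the two ends satisfy a relation `P * H 0 = Q * H (last)` with known leading term of `P`. -/
theorem exists_mul_eq_mul_of_chain {r : ℕ} {H : Fin (r + 2) → MvPolynomial σ K}
    (hH : ∀ k, H k ≠ 0)
    (hS : ∀ l : Fin (r + 1), ord.sPolynomial (H l.castSucc) (H l.succ) ∈ leadSpan ord H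
      (Set.Iio (ord.toSyn (ord.degree (H l.castSucc) ⊔ ord.degree (H l.succ))))) :
    ∃ P Q : MvPolynomial σ K, P ≠ 0 ∧ P * H 0 = Q * H (Fin.last (r + 1)) ∧
      ord.degree P + ∑ l : Fin (r + 1), ord.degree (H l.castSucc) =
        ∑ l : Fin (r + 1), (ord.degree (H l.castSucc) ⊔ ord.degree (H l.succ)) := by
  classical
  set L : Fin (r + 1) → σ →₀ ℕ := fun l => ord.degree (H l.castSucc) ⊔ ord.degree (H l.succ)
  have hrep (l : Fin (r + 1)) := exists_sum_eq_of_mem_leadSpan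
    (monicMultiple_sub_mem (hH _) (hH _) (d := L l) le_sup_left le_sup_right (hS l))
  choose h hsum hsupp using hrep
  let B (l : Fin (r + 1)) (k : Fin (r + 2)) : MvPolynomial σ K :=
    monomial (L l - ord.degree (H k)) (ord.leadingCoeff (H k))⁻¹
  -- Row l holds the coefficients of the l-th syzygy. The truncated subtraction in `B` is harmless:
  -- only k = l and k = l + 1 are used.
  let A (l : Fin (r + 1)) (k : Fin (r + 2)) : MvPolynomial σ K :=
    (if k = l.castSucc then B l k else 0) - (if k = l.succ then B l k else 0) - h l k
  have hAH (l : Fin (r + 1)) (k : Fin (r + 2)) : A l k * H k =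
      (if k = l.castSucc then monicMultiple ord (L l) (H k) else 0) -
        (if k = l.succ then monicMultiple ord (L l) (H k) else 0) - h l k * H k := by
    simp only [A, B, monicMultiple, sub_mul, ite_mul, zero_mul]
  have hrow (l : Fin (r + 1)) : ∑ k, A l k * H k = 0 := by
    simp only [hAH, Finset.sum_sub_distrib, Finset.sum_ite_eq', Finset.mem_univ, if_true]
    rw [← hsum l, sub_self]
  have hdeg (l : Fin (r + 1)) (k : Fin (r + 2)) :
      ord.toSyn (ord.degree (A l k * H k)) ≤ ord.toSyn (L l) := by
    rw [hAH]
    refine ord.degree_sub_le.trans (sup_le (ord.degree_sub_le.trans (sup_le ?_ ?_)) ?_)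
    · split_ifs with hk
      · exact degree_monicMultiple_le (hk ▸ le_sup_left)
      · simp
    · split_ifs with hk
      · exact degree_monicMultiple_le (hk ▸ le_sup_right)
      · simp
    · exact ord.degree_le_iff.2 fun s hs => (hsupp l k s hs).le
  have hcoeff (l : Fin (r + 1)) (k : Fin (r + 2)) : coeff (L l) (A l k * H k) =
      (if k = l.castSucc then 1 else 0) - (if k = l.succ then 1 else 0) := by
    have h0 : coeff (L l) (h l k * H k) = 0 := by
      by_contra hne
      exact lt_irrefl _ (hsupp l k _ (mem_support_iff.2 hne))
    rw [hAH, coeff_sub, coeff_sub, h0, sub_zero]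
    congr 1
    · split_ifs with hk
      · exact coeff_monicMultiple (hH k) (hk ▸ le_sup_left)
      · simp
    · split_ifs with hk
      · exact coeff_monicMultiple (hH k) (hk ▸ le_sup_right)
      · simp
  let M : Matrix (Fin (r + 1)) (Fin (r + 1)) (MvPolynomial σ K) := .of fun l k => A l k.castSucc
  -- Scaling column k by H k gives the entries of row l the common degree bound L l.
  let N : Matrix (Fin (r + 1)) (Fin (r + 1)) (MvPolynomial σ K) :=
    .of fun l k => H k.castSucc * M l k
  have hN : N.det = (∏ k : Fin (r + 1), H k.castSucc) * M.det := Matrix.det_mul_row _ _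
  have hNA (l k : Fin (r + 1)) : N l k = A l k.castSucc * H k.castSucc := mul_comm _ _
  obtain ⟨hdet, hdet'⟩ := degree_det_le_and_coeff_det (ord := ord) (N := N) (L := L)
    fun l k => by rw [hNA]; exact hdeg l _
  -- The top coefficients are 1 on the diagonal, -1 just above it and 0 elsewhere.
  have hone : (Matrix.of fun l k => coeff (L l) (N l k)).det = 1 := by
    rw [Matrix.det_of_isUpperTriangular]
    · refine Finset.prod_eq_one fun l _ => ?_
      rw [Matrix.of_apply, hNA, hcoeff, if_pos rfl, if_neg (Fin.castSucc_lt_succ).ne, sub_zero]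
    · intro l k hkl
      have hkl' : k < l := hkl
      rw [Matrix.of_apply, hNA, hcoeff, if_neg, if_neg, sub_zero]
      · rw [Fin.ext_iff]; simp; omega
      · rw [Fin.ext_iff]; simp; omega
  rw [hone] at hdet'
  have hN0 : N.det ≠ 0 := fun h0 => by simp [h0] at hdet'
  have hM0 : M.det ≠ 0 := fun h0 => hN0 (by rw [hN, h0, mul_zero])
  have hprod0 : (∏ k : Fin (r + 1), H k.castSucc) ≠ 0 := Finset.prod_ne_zero_iff.2 fun k _ => hH _
  have hNdeg : ord.degree N.det = ∑ l, L l := ord.toSyn.injective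
    (le_antisymm hdet (ord.le_degree (mem_support_iff.2 (by rw [hdet']; exact one_ne_zero))))
  -- Cramer's rule: move the last column to the right-hand side, apply the adjugate and read the
  -- entry 0.
  refine ⟨M.det, M.adjugate.mulVec (fun l => - A l (Fin.last _)) 0, hM0, ?_, ?_⟩
  · have hM : M.mulVec (fun k => H k.castSucc) =
        H (Fin.last _) • fun l => - A l (Fin.last _) := by
      ext1 l
      have := hrow l
      rw [Fin.sum_univ_castSucc, add_eq_zero_iff_eq_neg] at this
      simp only [Matrix.mulVec, dotProduct, M, Matrix.of_apply, Pi.smul_apply, smul_eq_mul]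
      rw [this]
      ring
    have := congrArg (fun v => M.adjugate.mulVec v 0) hM
    simpa [Matrix.mulVec_mulVec, Matrix.adjugate_mul, Matrix.smul_mulVec, Matrix.mulVec_smul,
      mul_comm] using this
  · rw [← hNdeg, hN, ord.degree_mul hprod0 hM0, ord.degree_prod fun k _ => hH _, add_comm]

end Determinant

/-! ### The criteria (B1)–(B3) and Buchberger's criterion -/

section Criteria

variable {n : ℕ} {K : Type*} [Field K] {ord : MonomialOrder (Fin n)}

/-- A chain satisfying the Extended Criterion represents the S-polynomial of its ends below the lcm
of their leading terms. -/
theorem sPolynomial_mem_leadSpan_of_EC {r : ℕ} {H : Fin (r + 2) → MvPolynomial (Fin n) K}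
    (hH : ∀ k, H k ≠ 0) (hEC : EC fun l => ord.degree (H l))
    (hS : ∀ l : Fin (r + 1), ord.sPolynomial (H l.castSucc) (H l.succ) ∈ leadSpan ord H
      (Set.Iio (ord.toSyn (ord.degree (H l.castSucc) ⊔ ord.degree (H l.succ))))) :
    ord.sPolynomial (H 0) (H (Fin.last (r + 1))) ∈ leadSpan ord H
      (Set.Iio (ord.toSyn (ord.degree (H 0) ⊔ ord.degree (H (Fin.last (r + 1)))))) := by
  obtain ⟨P, Q, hP, hPQ, hdeg⟩ := exists_mul_eq_mul_of_chain hH hS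
  obtain ⟨a, b, c, hab, ha, hb⟩ := UniqueFactorizationMonoid.exists_reduced_factors
    (H 0) (hH 0) (H (Fin.last (r + 1)))
  have hc0 : c ≠ 0 := fun h => hH 0 (by rw [← ha, h, zero_mul])
  have ha0 : a ≠ 0 := fun h => hH 0 (by rw [← ha, h, mul_zero])
  have hb0 : b ≠ 0 := fun h => hH (Fin.last _) (by rw [← hb, h, mul_zero])
  -- Cancelling c gives P * a = Q * b with a, b coprime.
  have hbP : b ∣ P := by
    refine hab.symm.dvd_of_dvd_mul_left (Dvd.intro_left Q (mul_left_cancel₀ hc0 ?_))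
    rw [← ha, ← hb] at hPQ
    linear_combination -hPQ
  obtain ⟨e, rfl⟩ := hbP
  have he0 : e ≠ 0 := right_ne_zero_of_mul hP
  refine sPolynomial_mem_leadSpan_of_eq_mul ha.symm hb.symm (hH 0) (hH _) ?_
  have da := ord.degree_mul hc0 ha0
  have db := ord.degree_mul hc0 hb0
  rw [ha] at da
  rw [hb] at db
  rw [ord.degree_mul hb0 he0] at hdeg
  ext x
  have dax := DFunLike.congr_fun da x
  have dbx := DFunLike.congr_fun db x
  have hdx := DFunLike.congr_fun hdeg x
  simp only [Finsupp.add_apply, Finsupp.finsetSum_apply, Finsupp.sup_apply] at dax dbx hdx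
  simp only [Finsupp.inf_apply, Finsupp.zero_apply]
  rcases hEC.2 x with h | h | h
  · simp only [Finsupp.inf_apply] at h
    omega
  -- Non-decreasing: deg_x P telescopes to the last degree minus the first, which is deg_x b - deg_x
  -- a; as b divides P, deg_x a = 0.
  · have hmax (l : Fin (r + 1)) : ord.degree (H l.castSucc) x ⊔ ord.degree (H l.succ) x =
        ord.degree (H l.succ) x := sup_eq_right.2 (h Fin.castSucc_lt_succ.le)
    have htel := Fin.sum_univ_castSucc fun l => ord.degree (H l) x
    rw [Fin.sum_univ_succ] at htel
    simp only [hmax] at hdx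
    omega
  -- Non-increasing: deg_x P = 0, hence deg_x b = 0.
  · have hmax (l : Fin (r + 1)) : ord.degree (H l.castSucc) x ⊔ ord.degree (H l.succ) x =
        ord.degree (H l.castSucc) x := sup_eq_left.2 (h Fin.castSucc_lt_succ.le)
    simp only [hmax] at hdx
    omega

variable {m : ℕ} {G : Fin m → MvPolynomial (Fin n) K}

theorem B1.sPolynomial_mem_leadSpan (hG : ∀ i, G i ≠ 0) {i j : Fin m} (h : B1 ord G i j) :
    ord.sPolynomial (G i) (G j) ∈
      leadSpan ord G (Set.Iio (ord.toSyn (ord.degree (G i) ⊔ ord.degree (G j)))) :=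
  sPolynomial_mem_leadSpan_of_eq_mul (one_mul _).symm (one_mul _).symm (hG i) (hG j) h

theorem B2.sPolynomial_mem_leadSpan (hG : ∀ i, G i ≠ 0) {i j : Fin m} (h : B2 ord G i j) :
    ord.sPolynomial (G i) (G j) ∈
      leadSpan ord G (Set.Iio (ord.toSyn (ord.degree (G i) ⊔ ord.degree (G j)))) := by
  obtain ⟨r, k, rfl, rfl, hle, hred⟩ := h
  refine sPolynomial_mem_of_monicMultiple_sub_mem (hG _) (hG _) ?_
  set d := ord.degree (G (k 0)) ⊔ ord.degree (G (k (Fin.last r)))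
  have hchain (l : Fin (r + 1)) : monicMultiple ord d (G (k 0)) - monicMultiple ord d (G (k l)) ∈
      leadSpan ord G (Set.Iio (ord.toSyn d)) := by
    induction l using Fin.induction with
    | zero => rw [sub_self]; exact zero_mem _
    | succ l ih =>
      rw [← sub_add_sub_cancel]
      exact add_mem ih (monicMultiple_sub_mem (hG _) (hG _) (hle _) (hle _)
        (hred l).sPolynomial_mem_leadSpan)
  exact hchain _

theorem B3.sPolynomial_mem_leadSpan (hG : ∀ i, G i ≠ 0) {i j : Fin m} (h : B3 ord G i j) :
    ord.sPolynomial (G i) (G j) ∈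
      leadSpan ord G (Set.Iio (ord.toSyn (ord.degree (G i) ⊔ ord.degree (G j)))) := by
  obtain ⟨r, k, rfl, rfl, hEC, hred⟩ := h
  cases r with
  | zero =>
    -- A chain with one index has equal ends.
    rw [show Fin.last 0 = 0 from rfl, ord.sPolynomial_self]
    exact zero_mem _
  | succ r =>
    exact leadSpan_comp_le k _ (sPolynomial_mem_leadSpan_of_EC (H := G ∘ k) (fun _ => hG _) hEC
      fun l => (hred l).sPolynomial_mem_leadSpan)

/-- **Buchberger's criterion**, with representations below the lcm of the leading terms. -/
theorem isGroebnerBasis_of_sPolynomial_mem_leadSpan (hG : ∀ i, G i ≠ 0)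
    (hS : ∀ i j, i < j → ord.sPolynomial (G i) (G j) ∈
      leadSpan ord G (Set.Iio (ord.toSyn (ord.degree (G i) ⊔ ord.degree (G j))))) :
    IsGroebnerBasis ord G := by
  intro p hp h0
  obtain ⟨d, hd⟩ := exists_mem_leadSpan_Iic (ord := ord) hp
  refine exists_degree_le_of_mem_leadSpan hG (fun i j => ?_) h0 d hd
  rcases lt_trichotomy i j with h | rfl | h
  · exact hS i j h
  · rw [ord.sPolynomial_self]
    exact zero_mem _
  · rw [ord.sPolynomial_antisymm, sup_comm]
    exact neg_mem (hS j i h)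

end Criteria

end ExtendedCriterion

theorem mainTheorem1 {n m : ℕ} {K : Type*} [Field K] (ord : MonomialOrder (Fin n))
    (G : Fin m → MvPolynomial (Fin n) K) (hG : ∀ i, G i ≠ 0) :
    ExtendedCriterion.IsGroebnerBasis ord G ↔
      ∀ i j : Fin m, i < j →
        ExtendedCriterion.B0 ord G i j ∨ ExtendedCriterion.B1 ord G i j ∨
        ExtendedCriterion.B2 ord G i j ∨ ExtendedCriterion.B3 ord G i j := by
  refine ⟨fun h i j _ => Or.inl (h.reducesToZero hG ?_), fun h => ?_⟩
  · exact sub_mem (Ideal.mul_mem_left _ _ (Ideal.subset_span ⟨i, rfl⟩))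
      (Ideal.mul_mem_left _ _ (Ideal.subset_span ⟨j, rfl⟩))
  · refine ExtendedCriterion.isGroebnerBasis_of_sPolynomial_mem_leadSpan hG fun i j hij => ?_
    rcases h i j hij with h | h | h | h
    · exact ExtendedCriterion.ReducesToZero.sPolynomial_mem_leadSpan h
    · exact h.sPolynomial_mem_leadSpan hG
    · exact h.sPolynomial_mem_leadSpan hG
    · exact h.sPolynomial_mem_leadSpan hG
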